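/- For $0<q<1$ and an integer $k\ge1$ let $S_k(q)=\sum_{n=1}^\infty\frac{1}{n^k}\,\frac{q^n}{1-q^n}$, and for real $s>0$ let $q_s=e^{-\pi\sqrt s}$. For every real $s>0$ and every integer $d\ge1$ the series $S_1(q_s^d)$ converges, and the ratio of its successive terms tends to $q_s^d=e^{-\pi d\sqrt s}$. Moreover the following five identities hold: $$\begin{aligned} S_1(q_7)-2S_1(q_7^2)+S_1(q_7^4)&=-\tfrac{\sqrt7}{24}\pi+\tfrac12\log 2,\\ 2S_1(q_2^2)-S_1(q_2^3)-S_1(q_2^6)&=\tfrac{5\sqrt2}{24}\pi+\tfrac14\log 2-\log 3,\\ S_1(q_1^3)+2S_1(q_1^4)-4S_1(q_1^6)+S_1(q_1^{12})&=\tfrac1{24}\pi+\log 2-\tfrac34\log 3,\\ 2S_1(q_1^4)+S_1(q_1^5)-4S_1(q_1^{10})+S_1(q_1^{20})&=\tfrac7{24}\pi+\log 2-\log 5,\\ S_1(q_3^2)+S_1(q_3^3)-3S_1(q_3^6)+S_1(q_3^{12})&=\tfrac{\sqrt3}{24}\pi+\tfrac13\log 2-\tfrac5{12}\log 3. \end{aligned}$$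 Furthermore, with $L_d=S_1(q_{1/3}^d)-3S_1(q_{1/3}^{2d})+S_1(q_{1/3}^{4d})$, $$\tfrac{5\sqrt3}{36}\pi+\tfrac{13}{12}\log 3-\log 7=L_7-2L_9+L_{21}.$$ This last identity converges faster than the previous five: its largest argument $q_{1/3}^7=e^{-\pi\sqrt{49/3}}$ is smaller than each of the largest arguments $q_7$, $q_2^2$, $q_1^3$, $q_1^4$, $q_3^2$ occurring in them. Each of its nine Lambert series $S_1(q_{1/3}^d)$, $d\in\{7,9,14,18,21,28,36,42,84\}$, satisfies $S_1(q_{1/3}^d)\le S_1(q_{1/3}^7)<3.062\times10^{-6}$. -/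

import Mathlib

noncomputable section

/-- The `n`-th term `(1 / n ^ k) * (q ^ n / (1 - q ^ n))` (for `n ≥ 1`) of the Lambert series. -/
def lambertTerm (k : ℕ) (q : ℝ) (n : ℕ) : ℝ :=
  1 / (n : ℝ) ^ k * (q ^ n / (1 - q ^ n))

/-- The Lambert series `S_k(q) = ∑_{n ≥ 1} (1 / n ^ k) * (q ^ n / (1 - q ^ n))`. -/
def lambertS (k : ℕ) (q : ℝ) : ℝ :=
  ∑' n : ℕ, lambertTerm k q (n + 1)

/-- `q_s = exp (-π √s)`. -/
def nomeQ (s : ℝ) : ℝ :=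
  Real.exp (-(Real.pi * Real.sqrt s))

/-- `L_d = S_1(q_{1/3}^d) - 3 S_1(q_{1/3}^{2d}) + S_1(q_{1/3}^{4d})`. -/
def lambertL (d : ℕ) : ℝ :=
  lambertS 1 (nomeQ (1 / 3) ^ d) - 3 * lambertS 1 (nomeQ (1 / 3) ^ (2 * d))
    + lambertS 1 (nomeQ (1 / 3) ^ (4 * d))

end

/-! ### Lambert series -/

/-! Expanding the geometric series and swapping sums gives `S_1(q) = -log ∏ (1 - q ^ n)`, so at `q =
exp (-2πy)` the series is, up to `πy / 12`, minus `log |η(iy)|` (`lambertS_one_eq_logEta`). Adding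
`log (Im z) / 4` makes `log |η|` invariant under `SL(2, ℤ)`, and summing this invariant over the `p
+ 1` index-`p` neighbours of `z` gives `p + 1` times its value minus `(p - 1) / 4 * log p`
(`logEta_hecke`).

The points that occur here are imaginary quadratic, so each is recorded by a positive definite form
up to equivalence and scaling (`formEta`). The Hecke relation then becomes a linear relation between
form classes (`formEta_hecke`). Class numbers are small enough that a few such relations eliminate
every class that is not attached to a Lambert series. Only logarithms of small primes and the `πy /
12` terms remain. -/

open Real in
theorem nomeQ_pow_eq_exp (s : ℝ) (d : ℕ) : nomeQ s ^ d = exp (-(d * (π * √s))) := by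
  rw [nomeQ, ← exp_nat_mul]
  ring_nf

theorem nomeQ_pos (s : ℝ) : 0 < nomeQ s := Real.exp_pos _

theorem nomeQ_lt_one {s : ℝ} (hs : 0 < s) : nomeQ s < 1 := by
  have := Real.sqrt_pos.2 hs
  have := Real.pi_pos
  rw [nomeQ, ← Real.exp_zero, Real.exp_lt_exp, neg_lt_zero]
  positivity

theorem lambertTerm_one_nonneg {q : ℝ} (h0 : 0 < q) (h1 : q < 1) (n : ℕ) :
    0 ≤ lambertTerm 1 q (n + 1) := by
  have : q ^ (n + 1) < 1 := pow_lt_one₀ h0.le h1 n.succ_ne_zero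
  have : 0 < 1 - q ^ (n + 1) := by linarith
  unfold lambertTerm
  positivity

theorem lambertTerm_one_le_geometric {q : ℝ} (h0 : 0 < q) (h1 : q < 1) (n : ℕ) :
    lambertTerm 1 q (n + 1) ≤ q / (1 - q) * q ^ n := by
  have hq : q ^ (n + 1) ≤ q := pow_le_of_le_one h0.le h1.le n.succ_ne_zero
  have hpos : 0 < 1 - q := by linarith
  have hn : (1 : ℝ) / ((n + 1 : ℕ) : ℝ) ^ 1 ≤ 1 := by
    rw [pow_one, div_le_one (by positivity)]
    exact_mod_cast Nat.succ_le_succ n.zero_le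
  have hq2 : q ^ (n + 1) / (1 - q ^ (n + 1)) ≤ q ^ (n + 1) / (1 - q) := by
    gcongr
  calc lambertTerm 1 q (n + 1) ≤ 1 * (q ^ (n + 1) / (1 - q)) := by
        unfold lambertTerm
        apply mul_le_mul hn hq2 _ zero_le_one
        have : 0 < 1 - q ^ (n + 1) := by linarith
        positivity
    _ = q / (1 - q) * q ^ n := by ring

theorem summable_lambertTerm_one {q : ℝ} (h0 : 0 < q) (h1 : q < 1) :
    Summable fun n : ℕ ↦ lambertTerm 1 q (n + 1) :=
  .of_nonneg_of_le (lambertTerm_one_nonneg h0 h1) (lambertTerm_one_le_geometric h0 h1)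
    ((summable_geometric_of_lt_one h0.le h1).mul_left _)

theorem lambertS_one_le {q : ℝ} (h0 : 0 < q) (h1 : q < 1) :
    lambertS 1 q ≤ q / (1 - q) ^ 2 := by
  calc lambertS 1 q ≤ ∑' n : ℕ, q / (1 - q) * q ^ n :=
        (summable_lambertTerm_one h0 h1).tsum_le_tsum (lambertTerm_one_le_geometric h0 h1)
          ((summable_geometric_of_lt_one h0.le h1).mul_left _)
    _ = q / (1 - q) ^ 2 := by
        rw [tsum_mul_left, tsum_geometric_of_lt_one h0.le h1, pow_two, div_mul_eq_div_div,
          ← div_eq_mul_inv]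

theorem lambertS_one_mono {p q : ℝ} (h0 : 0 < p) (hpq : p ≤ q) (h1 : q < 1) :
    lambertS 1 p ≤ lambertS 1 q := by
  refine (summable_lambertTerm_one h0 (hpq.trans_lt h1)).tsum_le_tsum (fun n ↦ ?_)
    (summable_lambertTerm_one (h0.trans_le hpq) h1)
  have : q ^ (n + 1) < 1 := pow_lt_one₀ (h0.le.trans hpq) h1 n.succ_ne_zero
  have h2 : 0 < 1 - q ^ (n + 1) := by linarith
  have h3 : p ^ (n + 1) ≤ q ^ (n + 1) := by gcongr
  unfold lambertTerm
  gcongr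
  exact pow_nonneg (h0.le.trans hpq) _

open Filter Topology in
theorem tendsto_lambertTerm_one_ratio {q : ℝ} (h0 : 0 < q) (h1 : q < 1) :
    Tendsto (fun n : ℕ ↦ lambertTerm 1 q (n + 2) / lambertTerm 1 q (n + 1)) atTop (𝓝 q) := by
  have hpow : Tendsto (fun n : ℕ ↦ q ^ n) atTop (𝓝 0) :=
    tendsto_pow_atTop_nhds_zero_of_lt_one h0.le h1
  have hp (k : ℕ) : Tendsto (fun n : ℕ ↦ 1 - q ^ (n + k)) atTop (𝓝 1) := by
    simpa using ((tendsto_add_atTop_iff_nat k).2 hpow).const_sub 1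
  have hn : Tendsto (fun n : ℕ ↦ ((n + 1 : ℕ) : ℝ) / ((n + 1 : ℕ) + 1)) atTop (𝓝 1) :=
    (tendsto_add_atTop_iff_nat 1).2 (tendsto_natCast_div_add_atTop (1 : ℝ))
  have := (hn.mul_const q).mul ((hp 1).div (hp 2) one_ne_zero)
  simp only [one_mul, div_one, mul_one] at this
  refine this.congr fun n ↦ ?_
  have e1 : 1 - q ^ (n + 1) ≠ 0 := (sub_pos.2 (pow_lt_one₀ h0.le h1 (by simp))).ne'
  have e2 : 1 - q ^ (n + 2) ≠ 0 := (sub_pos.2 (pow_lt_one₀ h0.le h1 (by simp))).ne'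
  simp only [lambertTerm, Pi.div_apply]
  push_cast
  have e3 : (n : ℝ) + 2 ≠ 0 := by positivity
  have e4 : (n : ℝ) + 1 ≠ 0 := by positivity
  rw [show (n : ℝ) + 1 + 1 = n + 2 by ring]
  field_simp
  ring

/-- The Lambert series `S_1(q)` is minus the logarithm of the Euler product. -/
theorem lambertS_one_eq_neg_tsum_log {q : ℝ} (h0 : 0 < q) (h1 : q < 1) :
    lambertS 1 q = -∑' m : ℕ, Real.log (1 - q ^ (m + 1)) := by
  have hlt (n : ℕ) : q ^ (n + 1) < 1 := pow_lt_one₀ h0.le h1 n.succ_ne_zero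
  -- Rows are geometric series, columns are Taylor series of `-log (1 - x)`; nonnegativity permits
  -- the swap.
  let f : ℕ → ℕ → ℝ := fun n m ↦ (q ^ (m + 1)) ^ (n + 1) / (n + 1)
  have hrow (n : ℕ) : HasSum (f n) (lambertTerm 1 q (n + 1)) := by
    have := (hasSum_geometric_of_lt_one (by positivity) (hlt n)).mul_left
      (q ^ (n + 1) / (n + 1 : ℝ))
    convert! this using 1
    · ext m
      simp only [f]
      ring
    · simp only [lambertTerm]
      push_cast
      ring
  have hcol (m : ℕ) : HasSum (fun n ↦ f n m) (-Real.log (1 - q ^ (m + 1))) :=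
    Real.hasSum_pow_div_log_of_abs_lt_one
      (by rw [abs_of_nonneg (by positivity)]; exact hlt m)
  have hf : Summable (Function.uncurry f) := by
    rw [summable_prod_of_nonneg fun x ↦ by simp only [Function.uncurry, f, Pi.zero_apply]; positivity]
    refine ⟨fun n ↦ (hrow n).summable, ?_⟩
    exact (summable_lambertTerm_one h0 h1).congr fun n ↦ ((hrow n).tsum_eq).symm
  rw [lambertS, ← tsum_neg, tsum_congr fun n ↦ (hrow n).tsum_eq.symm, ← hf.tsum_comm]
  exact tsum_congr fun m ↦ (hcol m).tsum_eq

theorem lambertS_one_eq_neg_log_tprod {q : ℝ} (h0 : 0 < q) (h1 : q < 1) :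
    lambertS 1 q = -Real.log (∏' m : ℕ, (1 - q ^ (m + 1))) := by
  have hlt (n : ℕ) : q ^ (n + 1) < 1 := pow_lt_one₀ h0.le h1 n.succ_ne_zero
  have hs : Summable fun m : ℕ ↦ Real.log (1 - q ^ (m + 1)) := by
    have : Summable fun m : ℕ ↦ -q ^ (m + 1) :=
      ((summable_nat_add_iff 1).2 (summable_geometric_of_lt_one h0.le h1)).neg
    simpa [sub_eq_add_neg] using Real.summable_log_one_add_of_summable this
  rw [lambertS_one_eq_neg_tsum_log h0 h1,
    ← Real.rexp_tsum_eq_tprod (fun n ↦ sub_pos.2 (hlt n)) hs, Real.log_exp]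

/-! ### Numerical bounds and comparison of nomes -/

theorem nomeQ_third_pow_seven_lt : nomeQ (1 / 3) ^ 7 < 3.0619 * (10 : ℝ)⁻¹ ^ 6 := by
  rw [nomeQ_pow_eq_exp]
  have hs : 0.577350 < √(1 / 3 : ℝ) := by
    rw [Real.lt_sqrt (by norm_num)]; norm_num
  have hπ := Real.pi_gt_d6
  have h1 : 12.6965 < 7 * (Real.pi * √(1 / 3 : ℝ)) := by nlinarith
  have h2 : Real.exp 12.6965 ≥ 2.7182818 ^ 12 * 2 * 1.00335 := by
    have hl := Real.log_two_lt_d9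
    -- The exponent is split as `12 + log 2 + 0.00335…`; the remainder is small enough for `1 + x ≤
    -- exp x`.
    have ha : Real.exp 12.6965
        = Real.exp 1 ^ 12 * Real.exp (Real.log 2) * Real.exp (0.6965 - Real.log 2) := by
      rw [← Real.exp_nat_mul, ← Real.exp_add, ← Real.exp_add]
      norm_num
    rw [ha, Real.exp_log two_pos]
    have hb : 1.00335 ≤ Real.exp (0.6965 - Real.log 2) := by
      linarith [Real.add_one_le_exp (0.6965 - Real.log 2)]
    have hc : 2.7182818 ≤ Real.exp 1 := by linarith [Real.exp_one_gt_d9]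
    gcongr
  have h3 : Real.exp 12.6965 < Real.exp (7 * (Real.pi * √(1 / 3 : ℝ))) := Real.exp_lt_exp.2 h1
  rw [Real.exp_neg]
  push_cast
  apply inv_lt_of_inv_lt₀ (by positivity)
  refine lt_of_lt_of_le ?_ (h2.le.trans h3.le)
  norm_num

theorem lambertS_nomeQ_third_pow_seven_lt :
    lambertS 1 (nomeQ (1 / 3) ^ 7) < 3.062 * (10 : ℝ)⁻¹ ^ 6 := by
  have hq := nomeQ_third_pow_seven_lt
  have h0 : 0 < nomeQ (1 / 3) ^ 7 := pow_pos (nomeQ_pos _) 7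
  refine (lambertS_one_le h0 (hq.trans (by norm_num))).trans_lt ?_
  set q := nomeQ (1 / 3) ^ 7
  have h1 : 0.99999 < 1 - q := by
    norm_num at hq ⊢
    linarith
  rw [div_lt_iff₀ (by positivity)]
  norm_num at hq ⊢
  nlinarith

theorem nomeQ_pow_lt_nomeQ_pow {s t : ℝ} {c d : ℕ} (h : (d : ℝ) * √t < c * √s) :
    nomeQ s ^ c < nomeQ t ^ d := by
  rw [nomeQ_pow_eq_exp, nomeQ_pow_eq_exp, Real.exp_lt_exp]
  nlinarith [Real.pi_pos]

/-! ### The Dedekind eta function and the Hecke relation -/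

theorem prod_one_sub_rootsOfUnity_mul {p : ℕ} {ζ : ℂ} (hζ : IsPrimitiveRoot ζ p) (hp : 0 < p)
    (y : ℂ) : ∏ j ∈ Finset.range p, (1 - ζ ^ j * y) = 1 - y ^ p := by
  have := congrArg (Polynomial.eval 1) (X_pow_sub_C_eq_prod hζ hp (rfl : y ^ p = y ^ p))
  simpa [Polynomial.eval_prod] using this.symm

/-- The Euler product `∏ (1 - x ^ n)`. -/
noncomputable def eulerProd (x : ℂ) : ℂ :=
  ∏' n : ℕ, (1 - x ^ (n + 1))

theorem eulerProd_ne_zero {x : ℂ} (hx : ‖x‖ < 1) : eulerProd x ≠ 0 := by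
  have hs : Summable fun n : ℕ ↦ ‖-x ^ (n + 1)‖ := by
    simpa using (summable_nat_add_iff 1).mpr (summable_geometric_of_lt_one (norm_nonneg _) hx)
  have := tprod_one_add_ne_zero_of_summable (f := fun n : ℕ ↦ -x ^ (n + 1)) (fun n h ↦ ?_) hs
  · simpa [eulerProd, sub_eq_add_neg] using this
  · have h1 : x ^ (n + 1) = 1 := by linear_combination -h
    have h2 : ‖x‖ ^ (n + 1) < 1 := pow_lt_one₀ (norm_nonneg _) hx n.succ_ne_zero
    rw [← norm_pow, h1] at h2
    simp at h2

theorem norm_pow_lt_one {x : ℂ} (hx : ‖x‖ < 1) {k : ℕ} (hk : k ≠ 0) : ‖x ^ k‖ < 1 := by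
  rw [norm_pow]
  exact pow_lt_one₀ (norm_nonneg _) hx hk

section Multiples

variable {p : ℕ}

theorem hasProd_ite_dvd (hp : 0 < p) {g : ℕ → ℂ} {a : ℂ}
    (hg : HasProd (fun m : ℕ ↦ g (p * (m + 1))) a) :
    HasProd (fun n : ℕ ↦ if p ∣ n + 1 then g (n + 1) else 1) a := by
  -- Index `n` stands for the integer `n + 1`, hence the `- 1` in the enumeration of multiples of
  -- `p`.
  have hi : Function.Injective fun m : ℕ ↦ p * (m + 1) - 1 := by
    intro m n h
    have h1 : 0 < p * (m + 1) := by positivity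
    have h2 : 0 < p * (n + 1) := by positivity
    have h3 : p * (m + 1) = p * (n + 1) := by
      simp only at h
      omega
    simpa using Nat.eq_of_mul_eq_mul_left hp h3
  rw [← hi.hasProd_iff]
  · convert! hg using 1
    ext m
    have h1 : p * (m + 1) - 1 + 1 = p * (m + 1) := Nat.sub_add_cancel (Nat.mul_pos hp m.succ_pos)
    simp [h1]
  · intro n hn
    refine if_neg fun ⟨k, hk⟩ ↦ hn ⟨k - 1, ?_⟩
    have hk0 : k ≠ 0 := by
      rintro rfl
      simp at hk
    have : k - 1 + 1 = k := by omega
    simp only [this, ← hk, Nat.add_sub_cancel]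

end Multiples

/-- The multiplicative form of the action of the Hecke operator at `p` on the Euler product. -/
theorem eulerProd_hecke {p : ℕ} (hp : p.Prime) {ζ : ℂ} (hζ : IsPrimitiveRoot ζ p) {x : ℂ}
    (hx : ‖x‖ < 1) :
    (∏ j ∈ Finset.range p, eulerProd (ζ ^ j * x)) * eulerProd (x ^ (p * p))
      = eulerProd (x ^ p) ^ (p + 1) := by
  have hζn : ‖ζ‖ = 1 := hζ.norm'_eq_one hp.ne_zero
  have hm {y : ℂ} (hy : ‖y‖ < 1) : HasProd (fun n : ℕ ↦ 1 - y ^ (n + 1)) (eulerProd y) :=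
    (ModularForm.multipliable_one_sub_pow hy).hasProd
  have hxp : ‖x ^ p‖ < 1 := norm_pow_lt_one hx hp.ne_zero
  have h1 : HasProd (fun n : ℕ ↦ ∏ j ∈ Finset.range p, (1 - (ζ ^ j * x) ^ (n + 1)))
      (∏ j ∈ Finset.range p, eulerProd (ζ ^ j * x)) :=
    hasProd_prod fun j _ ↦ hm (by simpa [hζn] using hx)
  have h2 : HasProd (fun n : ℕ ↦ if p ∣ n + 1 then (1 - (x ^ p) ^ (n + 1)) else 1)
      (eulerProd (x ^ (p * p))) := by
    refine hasProd_ite_dvd (g := fun n ↦ 1 - (x ^ p) ^ n) hp.pos ?_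
    convert! hm (norm_pow_lt_one hx (mul_ne_zero hp.ne_zero hp.ne_zero)) using 3 with m
    ring
  have h3 : HasProd (fun n : ℕ ↦ if p ∣ n + 1 then (1 - x ^ (n + 1)) ^ p else 1)
      (eulerProd (x ^ p) ^ p) := by
    refine hasProd_ite_dvd (g := fun n ↦ (1 - x ^ n) ^ p) hp.pos ?_
    convert! (hm hxp).pow p using 3 with m
    ring
  rw [pow_succ]
  refine (h1.mul h2).unique ?_
  convert! h3.mul (hm hxp) using 2 with n
  have hprod : ∏ j ∈ Finset.range p, (1 - (ζ ^ j * x) ^ (n + 1))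
      = ∏ j ∈ Finset.range p, (1 - (ζ ^ (n + 1)) ^ j * x ^ (n + 1)) := by
    refine Finset.prod_congr rfl fun j _ ↦ ?_
    rw [mul_pow, ← pow_mul, ← pow_mul, mul_comm j]
  rw [hprod]
  -- If `p` divides `n + 1`, the `p` factors coincide. Otherwise `ζ ^ (n + 1)` is again primitive
  -- and they multiply to `1 - x ^ (p * (n + 1))`.
  split_ifs with hd
  · rw [(hζ.pow_eq_one_iff_dvd _).2 hd]
    simp
  · have hζ' : IsPrimitiveRoot (ζ ^ (n + 1)) p :=
      hζ.pow_of_coprime _ ((Nat.Prime.coprime_iff_not_dvd hp).2 hd).symm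
    rw [prod_one_sub_rootsOfUnity_mul hζ' hp.pos]
    ring


/-! ### The modular invariant attached to `η` and its Hecke relation -/

section Eta

open ModularForm Function.Periodic

theorem eta_eq_qParam_mul_eulerProd (z : ℂ) : eta z = qParam 24 z * eulerProd (qParam 1 z) := rfl

theorem log_norm_eta {z : ℂ} (hz : 0 < z.im) :
    Real.log ‖eta z‖ = -(Real.pi * z.im / 12) + Real.log ‖eulerProd (qParam 1 z)‖ := by
  rw [eta_eq_qParam_mul_eulerProd, norm_mul, Real.log_mul
    (norm_ne_zero_iff.2 (qParam_ne_zero z))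
    (norm_ne_zero_iff.2 (eulerProd_ne_zero (by simpa using norm_qParam_lt_one one_pos hz))),
    norm_qParam, Real.log_exp]
  ring

/-- The `SL(2, ℤ)`-invariant function `log (|η(z)| (Im z) ^ (1 / 4))`. -/
noncomputable def logEta (z : ℂ) : ℝ :=
  Real.log ‖eta z‖ + Real.log z.im / 4

theorem logEta_add_one {z : ℂ} (hz : 0 < z.im) : logEta (z + 1) = logEta z := by
  have h : qParam 1 (z + 1) = qParam 1 z := by
    rw [qParam, qParam, Complex.exp_eq_exp_iff_exists_int]
    exact ⟨1, by push_cast; ring⟩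
  have hz' : 0 < (z + 1).im := by simpa using hz
  simp only [logEta, log_norm_eta hz, log_norm_eta hz', h]
  simp

/-- The factor `|z| ^ (1 / 2)` gained by `|η|` cancels against `Im (-1 / z) = Im z / |z| ^ 2`, which
enters with exponent `1 / 4`. -/
theorem logEta_neg_inv {z : ℂ} (hz : 0 < z.im) : logEta (-z⁻¹) = logEta z := by
  have hz0 : z ≠ 0 := by
    rintro rfl
    simp at hz
  have h := eta_comp_eq_csqrt_I_inv hz
  have hnorm (w : ℂ) (hw : w ≠ 0) : Real.log ‖Complex.sqrt w‖ = Real.log ‖w‖ / 2 := by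
    have : ‖Complex.sqrt w‖ ^ 2 = ‖w‖ := by
      rw [← norm_pow, Complex.sqrt, ← Complex.cpow_nat_mul]
      norm_num
    have := congrArg Real.log this
    rw [Real.log_pow] at this
    push_cast at this
    linarith
  have hs (w : ℂ) (hw : w ≠ 0) : ‖Complex.sqrt w‖ ≠ 0 := by
    rw [norm_ne_zero_iff, Complex.sqrt]
    simp [hw]
  have him : (-z⁻¹).im = z.im / ‖z‖ ^ 2 := by
    rw [Complex.neg_im, Complex.inv_im, Complex.normSq_eq_norm_sq]
    ring
  have hη : ‖eta (-z⁻¹)‖ = ‖Complex.sqrt Complex.I‖⁻¹ * (‖Complex.sqrt z‖ * ‖eta z‖) := by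
    simpa [neg_div] using congrArg norm h
  have hnz : ‖z‖ ≠ 0 := norm_ne_zero_iff.2 hz0
  have hez : ‖eta z‖ ≠ 0 := norm_ne_zero_iff.2 (eta_ne_zero hz)
  rw [logEta, logEta, hη, him, Real.log_mul (inv_ne_zero (hs _ Complex.I_ne_zero))
    (mul_ne_zero (hs _ hz0) hez), Real.log_mul (hs _ hz0) hez, Real.log_inv,
    hnorm _ Complex.I_ne_zero, hnorm _ hz0, Real.log_div hz.ne' (pow_ne_zero _ hnz),
    Real.log_pow]
  simp
  ring

/-- This is `eulerProd_hecke` at `x = exp (2πiz / p)`. The exponential prefactors of `η` balance,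
since `p y + p (y / p) = (p + 1) y`, so the constant comes only from the `log (Im)` terms. -/
theorem logEta_hecke {p : ℕ} (hp : p.Prime) {z : ℂ} (hz : 0 < z.im) :
    logEta (p * z) + ∑ j ∈ Finset.range p, logEta ((z + j) / p)
      = (p + 1) * logEta z - (p - 1) / 4 * Real.log p := by
  have hp0 : (p : ℝ) ≠ 0 := by exact_mod_cast hp.ne_zero
  have hpc : (p : ℂ) ≠ 0 := by exact_mod_cast hp.ne_zero
  have hppos : (0 : ℝ) < p := by exact_mod_cast hp.pos
  have hζ := Complex.isPrimitiveRoot_exp p hp.ne_zero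
  set x := qParam 1 (z / p) with hxdef
  have hdiv (w : ℂ) : (w / (p : ℂ)).im = w.im / p := by
    rw [← Complex.ofReal_natCast, Complex.div_ofReal_im]
  have hx : ‖x‖ < 1 := norm_qParam_lt_one one_pos (by rw [hdiv]; positivity)
  have hj (j : ℕ) : qParam 1 ((z + j) / p)
      = Complex.exp (2 * Real.pi * Complex.I / p) ^ j * x := by
    rw [hxdef, qParam, qParam, ← Complex.exp_nat_mul, ← Complex.exp_add]
    congr 1
    push_cast
    field_simp
    ring
  have hpow : x ^ p = qParam 1 z := by
    rw [hxdef, qParam, qParam, ← Complex.exp_nat_mul]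
    congr 1
    field_simp
  have hpow2 : x ^ (p * p) = qParam 1 (p * z) := by
    rw [pow_mul, hpow, qParam, qParam, ← Complex.exp_nat_mul]
    congr 1
    field_simp
  have himp : ((p : ℂ) * z).im = p * z.im := by simp
  have himj (j : ℕ) : ((z + j) / p).im = z.im / p := by rw [hdiv]; simp
  have hposj (j : ℕ) : 0 < ((z + j) / p).im := by rw [himj]; positivity
  have hposp : 0 < ((p : ℂ) * z).im := by rw [himp]; positivity
  have hne (j : ℕ) : ‖eulerProd (Complex.exp (2 * Real.pi * Complex.I / p) ^ j * x)‖ ≠ 0 := by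
    rw [← hj, norm_ne_zero_iff]
    exact eulerProd_ne_zero (norm_qParam_lt_one one_pos (hposj j))
  have hmain := congrArg (fun w : ℂ ↦ Real.log ‖w‖) (eulerProd_hecke hp hζ hx)
  simp only [norm_mul, norm_prod, norm_pow] at hmain
  rw [Real.log_mul (Finset.prod_ne_zero_iff.2 fun j _ ↦ by simpa using hne j) (by
      rw [hpow2, norm_ne_zero_iff]
      exact eulerProd_ne_zero (norm_qParam_lt_one one_pos hposp)),
    Real.log_prod (fun j _ ↦ by simpa using hne j), Real.log_pow, hpow2, hpow] at hmain
  have hsum : ∑ j ∈ Finset.range p, logEta ((z + j) / p)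
      = ∑ j ∈ Finset.range p,
          Real.log ‖eulerProd (Complex.exp (2 * Real.pi * Complex.I / p) ^ j * x)‖
        + (-(Real.pi * z.im / 12) + p * (Real.log z.im - Real.log p) / 4) := by
    rw [← sub_eq_iff_eq_add', ← Finset.sum_sub_distrib]
    rw [Finset.sum_congr rfl (g := fun _ ↦ -(Real.pi * (z.im / p) / 12)
      + (Real.log z.im - Real.log p) / 4)]
    · rw [Finset.sum_const, Finset.card_range, nsmul_eq_mul]
      field_simp
    · intro j _
      rw [logEta, log_norm_eta (hposj j), himj, hj, Real.log_div hz.ne' hp0]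
      ring
  rw [hsum, logEta, logEta, log_norm_eta hposp, log_norm_eta hz, himp,
    Real.log_mul hp0 hz.ne']
  push_cast at hmain
  linear_combination hmain

theorem lambertS_one_eq_logEta {y : ℝ} (hy : 0 < y) :
    lambertS 1 (Real.exp (-(2 * Real.pi * y)))
      = -logEta (y * Complex.I) + Real.log y / 4 - Real.pi * y / 12 := by
  have h1 : Real.exp (-(2 * Real.pi * y)) < 1 := by
    have := Real.pi_pos
    rw [← Real.exp_zero, Real.exp_lt_exp, neg_lt_zero]
    positivity
  have him : ((y : ℂ) * Complex.I).im = y := by simp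
  have hq : qParam 1 ((y : ℂ) * Complex.I) = (Real.exp (-(2 * Real.pi * y)) : ℝ) := by
    rw [qParam, Complex.ofReal_exp]
    congr 1
    push_cast
    linear_combination (2 * Real.pi * y : ℂ) * Complex.I_sq
  have hn : ‖eulerProd (qParam 1 (y * Complex.I))‖
      = ∏' m : ℕ, (1 - Real.exp (-(2 * Real.pi * y)) ^ (m + 1)) := by
    rw [hq, eulerProd, (multipliable_one_sub_pow (by
      rw [Complex.norm_real, Real.norm_of_nonneg (Real.exp_pos _).le]
      exact h1)).norm_tprod]
    refine tprod_congr fun m ↦ ?_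
    have : Real.exp (-(2 * Real.pi * y)) ^ (m + 1) < 1 :=
      pow_lt_one₀ (Real.exp_pos _).le h1 m.succ_ne_zero
    rw [← Complex.ofReal_pow, ← Complex.ofReal_one, ← Complex.ofReal_sub, Complex.norm_real,
      Real.norm_of_nonneg (by linarith)]
  rw [lambertS_one_eq_neg_log_tprod (Real.exp_pos _) h1, ← hn, logEta,
    log_norm_eta (by rwa [him]), him]
  ring

end Eta

/-! ### Invariants of binary quadratic forms -/

/-- `logEta` at the root in the upper half-plane of the positive definite form `(a, b, c)`. -/
noncomputable def formEta (a b c : ℝ) : ℝ :=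
  logEta ⟨-b / (2 * a), √(4 * a * c - b ^ 2) / (2 * a)⟩

/-- A real quadratic has at most one root in the upper half-plane, so later comparisons of points
reduce to polynomial identities without square roots. -/
theorem logEta_eq_formEta {a b c : ℝ} (ha : 0 < a) {z : ℂ} (hz : 0 < z.im)
    (h : a * z ^ 2 + b * z + c = 0) : logEta z = formEta a b c := by
  have hre := congrArg Complex.re h
  have him := congrArg Complex.im h
  simp [pow_two] at hre him
  have hx : 2 * a * z.re + b = 0 := by
    have : z.im * (2 * a * z.re + b) = 0 := by linear_combination him
    exact (mul_eq_zero.1 this).resolve_left hz.ne'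
  have hd : 4 * a * c - b ^ 2 = (2 * a * z.im) ^ 2 := by
    linear_combination (4 * a) * hre - (2 * a * z.re + b) * hx
  rw [formEta, hd, Real.sqrt_sq (by positivity)]
  congr 1
  apply Complex.ext
  · simp only
    rw [eq_div_iff (by positivity)]
    linarith
  · simp only
    field_simp

theorem exists_root_form {a b c : ℝ} (ha : 0 < a) (hd : b ^ 2 < 4 * a * c) :
    ∃ z : ℂ, 0 < z.im ∧ (a * z ^ 2 + b * z + c : ℂ) = 0 := by
  have hD : 0 < 4 * a * c - b ^ 2 := by linarith
  have hs := Real.mul_self_sqrt hD.le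
  rw [pow_two b] at hs
  refine ⟨⟨-b / (2 * a), √(4 * a * c - b ^ 2) / (2 * a)⟩, ?_, ?_⟩
  · have := Real.sqrt_pos.2 hD
    simp only
    positivity
  · apply Complex.ext
    · simp [pow_two]
      generalize √(4 * a * c - b * b) = r at *
      field_simp
      linear_combination -hs
    · simp [pow_two]
      field_simp
      ring

theorem logEta_add_int {z : ℂ} (hz : 0 < z.im) (n : ℤ) : logEta (z + n) = logEta z := by
  induction n with
  | zero => simp
  | succ k ih =>
    rw [← ih]
    push_cast
    rw [← add_assoc, logEta_add_one (by simpa using hz)]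
  | pred k ih =>
    rw [← ih, ← logEta_add_one (by simpa using hz)]
    push_cast
    ring_nf

/-- Invariance of `formEta` under scaling and translation of the form. -/
theorem formEta_shift {a b c a' b' c' : ℝ} (n : ℤ) {k : ℝ} (ha : 0 < a) (hd : b ^ 2 < 4 * a * c)
    (hk : 0 < k) (h1 : a = k * a') (h2 : b + 2 * a * n = k * b')
    (h3 : a * n ^ 2 + b * n + c = k * c') : formEta a b c = formEta a' b' c' := by
  obtain ⟨z, hz, h⟩ := exists_root_form ha hd
  have ha' : 0 < a' := pos_of_mul_pos_right (h1 ▸ ha) hk.le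
  have hkc : (k : ℂ) ≠ 0 := by exact_mod_cast hk.ne'
  rw [← logEta_eq_formEta ha hz h, ← logEta_add_int hz (-n)]
  refine logEta_eq_formEta ha' (by simpa using hz) (mul_left_cancel₀ hkc ?_)
  apply_fun (fun x : ℝ ↦ (x : ℂ)) at h1 h2 h3
  push_cast at h1 h2 h3 ⊢
  linear_combination h - (z - n) ^ 2 * h1 - (z - n) * h2 - h3

/-- Invariance of `formEta` under inversion. -/
theorem formEta_inv {a b c : ℝ} (ha : 0 < a) (hd : b ^ 2 < 4 * a * c) :
    formEta a b c = formEta c (-b) a := by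
  obtain ⟨z, hz, h⟩ := exists_root_form ha hd
  have hz0 : z ≠ 0 := by
    rintro rfl
    simp at hz
  have hc : 0 < c := by nlinarith [sq_nonneg b]
  rw [← logEta_eq_formEta ha hz h, ← logEta_neg_inv hz]
  refine logEta_eq_formEta hc ?_ ?_
  · rw [Complex.neg_im, Complex.inv_im]
    have := Complex.normSq_pos.2 hz0
    rw [neg_div, neg_neg]
    positivity
  · push_cast
    field_simp
    linear_combination h

/-- Invariance of `formEta` under a translation, an inversion, a translation and a scaling. -/
theorem formEta_equiv {a b c a' b' c' : ℝ} (n m : ℤ) {k : ℝ} (ha : 0 < a)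
    (hd : b ^ 2 < 4 * a * c) (hk : 0 < k)
    (h1 : a * n ^ 2 + b * n + c = k * a')
    (h2 : -(b + 2 * a * n) + 2 * (a * n ^ 2 + b * n + c) * m = k * b')
    (h3 : (a * n ^ 2 + b * n + c) * m ^ 2 - (b + 2 * a * n) * m + a = k * c') :
    formEta a b c = formEta a' b' c' := by
  have hd' : (b + 2 * a * n) ^ 2 < 4 * a * (a * n ^ 2 + b * n + c) := by linarith
  have hc : 0 < a * n ^ 2 + b * n + c := by nlinarith [sq_nonneg (b + 2 * a * n)]
  -- One round of Gauss reduction; `k` removes a common factor of the coefficients.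
  rw [formEta_shift n ha hd one_pos (one_mul _).symm (one_mul _).symm (one_mul _).symm,
    formEta_inv ha hd']
  exact formEta_shift m hc (by linarith) hk h1 h2 (by linarith)

/-- The forms on the left come from substituting `z = w / p` and `z = p w - j` into the form of `z`.
-/
theorem formEta_hecke {p : ℕ} (hp : p.Prime) {a b c : ℝ} (ha : 0 < a) (hd : b ^ 2 < 4 * a * c) :
    formEta a (p * b) (p ^ 2 * c)
      + ∑ j ∈ Finset.range p, formEta (p ^ 2 * a) (p * (b - 2 * a * j)) (a * j ^ 2 - b * j + c)
      = (p + 1) * formEta a b c - (p - 1) / 4 * Real.log p := by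
  obtain ⟨z, hz, h⟩ := exists_root_form ha hd
  have hp0 : (0 : ℝ) < p := by exact_mod_cast hp.pos
  have hpc : (p : ℂ) ≠ 0 := by exact_mod_cast hp.ne_zero
  rw [← logEta_eq_formEta ha hz h, ← logEta_hecke hp hz]
  congr 1
  · refine (logEta_eq_formEta ha (by simpa using mul_pos hp0 hz) ?_).symm
    push_cast
    linear_combination (p : ℂ) ^ 2 * h
  · refine Finset.sum_congr rfl fun j _ ↦ (logEta_eq_formEta (by positivity) ?_ ?_).symm
    · rw [← Complex.ofReal_natCast p, Complex.div_ofReal_im]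
      simpa using div_pos hz hp0
    · push_cast
      field_simp
      linear_combination h

/-- Here `q_s ^ d = exp (-2πy)` with `y = d√s / 2`, and `iy` is the root of `(4, 0, d² s)`, from
which `k` is divided out. -/
theorem lambertS_nomeQ_pow {s : ℝ} (hs : 0 < s) {d : ℕ} (hd : 0 < d) {a c k : ℝ}
    (hk : 0 < k) (ha : 4 = k * a) (hc : (d : ℝ) ^ 2 * s = k * c) :
    lambertS 1 (nomeQ s ^ d) = -formEta a 0 c
      + (Real.log d + Real.log s / 2 - Real.log 2) / 4 - Real.pi * (d * √s) / 24 := by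
  have hd' : (0 : ℝ) < d := by exact_mod_cast hd
  have hs' := Real.sqrt_pos.2 hs
  have ha' : 0 < a := by
    apply pos_of_mul_pos_right _ hk.le
    rw [← ha]
    norm_num
  have hkc : (k : ℂ) ≠ 0 := by exact_mod_cast hk.ne'
  have hy : 0 < d * √s / 2 := by positivity
  have hq : nomeQ s ^ d = Real.exp (-(2 * Real.pi * (d * √s / 2))) := by
    rw [nomeQ_pow_eq_exp]
    ring_nf
  rw [hq, lambertS_one_eq_logEta hy, logEta_eq_formEta (b := 0) (c := c) ha' (by simpa using hy),
    Real.log_div (by positivity) two_ne_zero, Real.log_mul hd'.ne' hs'.ne', Real.log_sqrt hs.le]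
  · ring
  · apply mul_left_cancel₀ hkc
    have hs2 := Real.sq_sqrt hs.le
    apply_fun (fun x : ℝ ↦ (x : ℂ)) at ha hc hs2
    push_cast at ha hc hs2 ⊢
    linear_combination (d ^ 2 * (√s : ℂ) ^ 2 * k * a / 4) * Complex.I_sq + (d ^ 2 * (√s : ℂ) ^ 2 / 4) * ha
      - hc - d ^ 2 * hs2

/-! ### The identities -/

section Identities

open Real

/-- The relation at `(1, 0, 7)` involves the three forms of the series and `(1, -1, 2)`. The
relation at `(1, -1, 2)`, two of whose neighbours return to it, expresses that class through `(1, 0,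
7)`. -/
theorem lambertS_identity_sqrt_seven :
    lambertS 1 (nomeQ 7) - 2 * lambertS 1 (nomeQ 7 ^ 2) + lambertS 1 (nomeQ 7 ^ 4)
      = -(√7 / 24) * π + 1 / 2 * log 2 := by
  have h1 := formEta_hecke Nat.prime_two (a := 1) (b := 0) (c := 7) (by norm_num) (by norm_num)
  have h2 := formEta_hecke Nat.prime_two (a := 1) (b := -1) (c := 2) (by norm_num) (by norm_num)
  norm_num [Finset.sum_range_succ] at h1 h2
  have e1 : formEta 4 (-4) 8 = formEta 1 (-1) 2 := by
    apply formEta_shift 0 (k := 4) <;> norm_num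
  have e2 : formEta 4 (-2) 2 = formEta 1 (-1) 2 := by
    apply formEta_equiv 0 (-1) (k := 2) <;> norm_num
  have e3 : formEta 4 (-6) 4 = formEta 1 (-1) 2 := by
    apply formEta_equiv 1 0 (k := 2) <;> norm_num
  have e4 : formEta 1 (-2) 8 = formEta 1 0 7 := by
    apply formEta_shift 1 (k := 1) <;> norm_num
  have s1 : lambertS 1 (nomeQ 7 ^ 1) = _ :=
    lambertS_nomeQ_pow (a := 4) (c := 7) (k := 1) (by norm_num) (by norm_num) one_pos
      (by norm_num) (by norm_num)
  have s2 : lambertS 1 (nomeQ 7 ^ 2) = _ :=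
    lambertS_nomeQ_pow (a := 1) (c := 7) (k := 4) (by norm_num) (by norm_num) (by norm_num)
      (by norm_num) (by norm_num)
  have s4 : lambertS 1 (nomeQ 7 ^ 4) = _ :=
    lambertS_nomeQ_pow (a := 1) (c := 28) (k := 4) (by norm_num) (by norm_num) (by norm_num)
      (by norm_num) (by norm_num)
  rw [pow_one] at s1
  rw [s1, s2, s4]
  push_cast
  rw [log_four_eq, log_one]
  linarith

/-- Since 3 splits in `ℚ(√-2)`, two of the four neighbours of `(1, 0, 2)` return to it; the other
two belong to the series. -/
theorem lambertS_identity_sqrt_two :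
    2 * lambertS 1 (nomeQ 2 ^ 2) - lambertS 1 (nomeQ 2 ^ 3) - lambertS 1 (nomeQ 2 ^ 6)
      = 5 * √2 / 24 * π + 1 / 4 * log 2 - log 3 := by
  have h1 := formEta_hecke Nat.prime_three (a := 1) (b := 0) (c := 2) (by norm_num) (by norm_num)
  norm_num [Finset.sum_range_succ] at h1
  have e1 : formEta 9 0 2 = formEta 2 0 9 := by
    apply formEta_equiv 0 0 (k := 1) <;> norm_num
  have e2 : formEta 9 (-6) 3 = formEta 1 0 2 := by
    apply formEta_equiv 0 (-1) (k := 3) <;> norm_num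
  have e3 : formEta 9 (-12) 6 = formEta 1 0 2 := by
    apply formEta_equiv 1 1 (k := 3) <;> norm_num
  have s2 : lambertS 1 (nomeQ 2 ^ 2) = _ :=
    lambertS_nomeQ_pow (a := 1) (c := 2) (k := 4) (by norm_num) (by norm_num) (by norm_num)
      (by norm_num) (by norm_num)
  have s3 : lambertS 1 (nomeQ 2 ^ 3) = _ :=
    lambertS_nomeQ_pow (a := 2) (c := 9) (k := 2) (by norm_num) (by norm_num) (by norm_num)
      (by norm_num) (by norm_num)
  have s6 : lambertS 1 (nomeQ 2 ^ 6) = _ :=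
    lambertS_nomeQ_pow (a := 1) (c := 18) (k := 4) (by norm_num) (by norm_num) (by norm_num)
      (by norm_num) (by norm_num)
  have l6 : log 6 = log 2 + log 3 := by rw [← log_mul] <;> norm_num
  rw [s2, s3, s6]
  push_cast
  rw [l6]
  linarith

theorem formEta_one_zero_four : formEta 1 0 4 = formEta 1 0 1 - 1 / 8 * log 2 := by
  have h1 := formEta_hecke Nat.prime_two (a := 1) (b := 0) (c := 1) (by norm_num) (by norm_num)
  norm_num [Finset.sum_range_succ] at h1
  have e1 : formEta 4 0 1 = formEta 1 0 4 := by
    apply formEta_equiv 0 0 (k := 1) <;> norm_num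
  have e2 : formEta 4 (-4) 2 = formEta 1 0 1 := by
    apply formEta_equiv 0 (-1) (k := 2) <;> norm_num
  linarith

/-- The extra class `(2, -2, 5)` in the 2-relation at `(1, 0, 9)` is removed by the 3-relation at
`(1, 0, 1)`; then `(1, 0, 1)` is traded for `(1, 0, 4)`. -/
theorem lambertS_identity_one_three :
    lambertS 1 (nomeQ 1 ^ 3) + 2 * lambertS 1 (nomeQ 1 ^ 4) - 4 * lambertS 1 (nomeQ 1 ^ 6)
        + lambertS 1 (nomeQ 1 ^ 12)
      = 1 / 24 * π + log 2 - 3 / 4 * log 3 := by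
  have h1 := formEta_hecke Nat.prime_two (a := 1) (b := 0) (c := 9) (by norm_num) (by norm_num)
  have h2 := formEta_hecke Nat.prime_three (a := 1) (b := 0) (c := 1) (by norm_num) (by norm_num)
  have h3 := formEta_one_zero_four
  norm_num [Finset.sum_range_succ] at h1 h2
  have e1 : formEta 4 (-4) 10 = formEta 2 (-2) 5 := by
    apply formEta_shift 0 (k := 2) <;> norm_num
  have e2 : formEta 9 0 1 = formEta 1 0 9 := by
    apply formEta_equiv 0 0 (k := 1) <;> norm_num
  have e3 : formEta 9 (-6) 2 = formEta 2 (-2) 5 := by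
    apply formEta_equiv 0 (-2) (k := 1) <;> norm_num
  have e4 : formEta 9 (-12) 5 = formEta 2 (-2) 5 := by
    apply formEta_equiv 1 1 (k := 1) <;> norm_num
  have s3 : lambertS 1 (nomeQ 1 ^ 3) = _ :=
    lambertS_nomeQ_pow (a := 4) (c := 9) (k := 1) (by norm_num) (by norm_num) (by norm_num)
      (by norm_num) (by norm_num)
  have s4 : lambertS 1 (nomeQ 1 ^ 4) = _ :=
    lambertS_nomeQ_pow (a := 1) (c := 4) (k := 4) (by norm_num) (by norm_num) (by norm_num)
      (by norm_num) (by norm_num)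
  have s6 : lambertS 1 (nomeQ 1 ^ 6) = _ :=
    lambertS_nomeQ_pow (a := 1) (c := 9) (k := 4) (by norm_num) (by norm_num) (by norm_num)
      (by norm_num) (by norm_num)
  have s12 : lambertS 1 (nomeQ 1 ^ 12) = _ :=
    lambertS_nomeQ_pow (a := 1) (c := 36) (k := 4) (by norm_num) (by norm_num) (by norm_num)
      (by norm_num) (by norm_num)
  have l6 : log 6 = log 2 + log 3 := by rw [← log_mul] <;> norm_num
  have l12 : log 12 = log 4 + log 3 := by rw [← log_mul] <;> norm_num
  rw [s3, s4, s6, s12]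
  push_cast
  rw [l12, log_four_eq, l6, log_one, sqrt_one]
  linarith

/-- Same elimination with 5 for 3 and `(2, -2, 13)` as the extra class; 5 splits, so two neighbours
return to `(1, 0, 1)`. -/
theorem lambertS_identity_one_five :
    2 * lambertS 1 (nomeQ 1 ^ 4) + lambertS 1 (nomeQ 1 ^ 5) - 4 * lambertS 1 (nomeQ 1 ^ 10)
        + lambertS 1 (nomeQ 1 ^ 20)
      = 7 / 24 * π + log 2 - log 5 := by
  have h1 := formEta_hecke Nat.prime_two (a := 1) (b := 0) (c := 25) (by norm_num) (by norm_num)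
  have h2 := formEta_hecke Nat.prime_five (a := 1) (b := 0) (c := 1) (by norm_num) (by norm_num)
  have h3 := formEta_one_zero_four
  norm_num [Finset.sum_range_succ] at h1 h2
  have e1 : formEta 4 (-4) 26 = formEta 2 (-2) 13 := by
    apply formEta_shift 0 (k := 2) <;> norm_num
  have e2 : formEta 25 0 1 = formEta 1 0 25 := by
    apply formEta_equiv 0 0 (k := 1) <;> norm_num
  have e3 : formEta 25 (-10) 2 = formEta 2 (-2) 13 := by
    apply formEta_equiv 0 (-3) (k := 1) <;> norm_num
  have e4 : formEta 25 (-20) 5 = formEta 1 0 1 := by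
    apply formEta_equiv 0 (-2) (k := 5) <;> norm_num
  have e5 : formEta 25 (-30) 10 = formEta 1 0 1 := by
    apply formEta_equiv 1 2 (k := 5) <;> norm_num
  have e6 : formEta 25 (-40) 17 = formEta 2 (-2) 13 := by
    apply formEta_equiv 1 2 (k := 1) <;> norm_num
  have s4 : lambertS 1 (nomeQ 1 ^ 4) = _ :=
    lambertS_nomeQ_pow (a := 1) (c := 4) (k := 4) (by norm_num) (by norm_num) (by norm_num)
      (by norm_num) (by norm_num)
  have s5 : lambertS 1 (nomeQ 1 ^ 5) = _ :=
    lambertS_nomeQ_pow (a := 4) (c := 25) (k := 1) (by norm_num) (by norm_num) (by norm_num)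
      (by norm_num) (by norm_num)
  have s10 : lambertS 1 (nomeQ 1 ^ 10) = _ :=
    lambertS_nomeQ_pow (a := 1) (c := 25) (k := 4) (by norm_num) (by norm_num) (by norm_num)
      (by norm_num) (by norm_num)
  have s20 : lambertS 1 (nomeQ 1 ^ 20) = _ :=
    lambertS_nomeQ_pow (a := 1) (c := 100) (k := 4) (by norm_num) (by norm_num) (by norm_num)
      (by norm_num) (by norm_num)
  have l10 : log 10 = log 2 + log 5 := by rw [← log_mul] <;> norm_num
  have l20 : log 20 = log 4 + log 5 := by rw [← log_mul] <;> norm_num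
  rw [s4, s5, s10, s20]
  push_cast
  rw [l20, log_four_eq, l10, log_one, sqrt_one]
  linarith

theorem formEta_one_neg_one_seven :
    formEta 1 (-1) 7 = formEta 1 (-1) 1 - 1 / 6 * log 3 := by
  have h1 := formEta_hecke Nat.prime_three (a := 1) (b := -1) (c := 1) (by norm_num) (by norm_num)
  norm_num [Finset.sum_range_succ] at h1
  have e1 : formEta 1 (-3) 9 = formEta 1 (-1) 7 := by
    apply formEta_shift 1 (k := 1) <;> norm_num
  have e2 : formEta 9 (-3) 1 = formEta 1 (-1) 7 := by
    apply formEta_equiv 0 (-2) (k := 1) <;> norm_num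
  have e3 : formEta 9 (-9) 3 = formEta 1 (-1) 1 := by
    apply formEta_equiv 0 (-2) (k := 3) <;> norm_num
  have e4 : formEta 9 (-15) 7 = formEta 1 (-1) 7 := by
    apply formEta_equiv 1 1 (k := 1) <;> norm_num
  linarith

theorem formEta_one_zero_twentySeven :
    formEta 1 0 108 + formEta 4 0 27 - 3 * formEta 1 0 27
      = -formEta 1 (-1) 7 - 1 / 4 * log 2 := by
  have h1 := formEta_hecke Nat.prime_two (a := 1) (b := 0) (c := 27) (by norm_num) (by norm_num)
  norm_num [Finset.sum_range_succ] at h1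
  have e1 : formEta 4 (-4) 28 = formEta 1 (-1) 7 := by
    apply formEta_shift 0 (k := 4) <;> norm_num
  linarith

/-- All three 2-neighbours of `(1, -1, 1)` are equivalent to `(1, 0, 3)`, which links the series for
`q_3 ^ 2` to `(1, -1, 7)`, the class left by the other three series. -/
theorem lambertS_identity_sqrt_three :
    lambertS 1 (nomeQ 3 ^ 2) + lambertS 1 (nomeQ 3 ^ 3) - 3 * lambertS 1 (nomeQ 3 ^ 6)
        + lambertS 1 (nomeQ 3 ^ 12)
      = √3 / 24 * π + 1 / 3 * log 2 - 5 / 12 * log 3 := by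
  have h1 := formEta_hecke Nat.prime_two (a := 1) (b := -1) (c := 1) (by norm_num) (by norm_num)
  have h2 := formEta_one_neg_one_seven
  have h3 := formEta_one_zero_twentySeven
  norm_num [Finset.sum_range_succ] at h1
  have e1 : formEta 1 (-2) 4 = formEta 1 0 3 := by
    apply formEta_shift 1 (k := 1) <;> norm_num
  have e2 : formEta 4 (-2) 1 = formEta 1 0 3 := by
    apply formEta_equiv 0 (-1) (k := 1) <;> norm_num
  have e3 : formEta 4 (-6) 3 = formEta 1 0 3 := by
    apply formEta_equiv 1 1 (k := 1) <;> norm_num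
  have s2 : lambertS 1 (nomeQ 3 ^ 2) = _ :=
    lambertS_nomeQ_pow (a := 1) (c := 3) (k := 4) (by norm_num) (by norm_num) (by norm_num)
      (by norm_num) (by norm_num)
  have s3 : lambertS 1 (nomeQ 3 ^ 3) = _ :=
    lambertS_nomeQ_pow (a := 4) (c := 27) (k := 1) (by norm_num) (by norm_num) (by norm_num)
      (by norm_num) (by norm_num)
  have s6 : lambertS 1 (nomeQ 3 ^ 6) = _ :=
    lambertS_nomeQ_pow (a := 1) (c := 27) (k := 4) (by norm_num) (by norm_num) (by norm_num)
      (by norm_num) (by norm_num)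
  have s12 : lambertS 1 (nomeQ 3 ^ 12) = _ :=
    lambertS_nomeQ_pow (a := 1) (c := 108) (k := 4) (by norm_num) (by norm_num) (by norm_num)
      (by norm_num) (by norm_num)
  have l6 : log 6 = log 2 + log 3 := by rw [← log_mul] <;> norm_num
  have l12 : log 12 = log 4 + log 3 := by rw [← log_mul] <;> norm_num
  rw [s2, s3, s6, s12]
  push_cast
  rw [l12, log_four_eq, l6]
  linarith

/-- `lambertL d` in terms of forms proportional to `(12, 0, d ^ 2)`, `(3, 0, d ^ 2)` and
`(3, 0, 4 * d ^ 2)`. -/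
theorem lambertL_eq {d : ℕ} (hd : 0 < d) {a c k : ℝ} (hk : 0 < k) (ha : 3 = k * a)
    (hc : (d : ℝ) ^ 2 = k * c) :
    lambertL d = -(formEta a 0 (4 * c) + formEta (4 * a) 0 c - 3 * formEta a 0 c)
      + (log 3 / 2 - log d) / 4 + π * (d * √3) / 72 := by
  have hs : √(1 / 3 : ℝ) = √3 / 3 := by
    rw [sqrt_div_self', one_div, sqrt_inv, one_div]
  have hd0 : (d : ℝ) ≠ 0 := by exact_mod_cast hd.ne'
  have s1 : lambertS 1 (nomeQ (1 / 3) ^ d) = _ :=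
    lambertS_nomeQ_pow (a := 4 * a) (c := c) (k := k / 3) (by norm_num) hd (by positivity)
      (by linarith) (by rw [hc]; ring)
  have s2 : lambertS 1 (nomeQ (1 / 3) ^ (2 * d)) = _ :=
    lambertS_nomeQ_pow (a := a) (c := c) (k := 4 * k / 3) (by norm_num) (by positivity)
      (by positivity) (by linarith) (by push_cast; linear_combination 4 / 3 * hc)
  have s4 : lambertS 1 (nomeQ (1 / 3) ^ (4 * d)) = _ :=
    lambertS_nomeQ_pow (a := a) (c := 4 * c) (k := 4 * k / 3) (by norm_num) (by positivity)
      (by positivity) (by linarith) (by push_cast; linear_combination 16 / 3 * hc)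
  rw [lambertL, s1, s2, s4]
  push_cast
  rw [log_mul two_ne_zero hd0, log_mul four_ne_zero hd0, log_four_eq, hs, one_div, log_inv]
  ring

/-- By 2-relations, `L_7`, `L_9` and `L_21` each reduce to one class: `(3, -3, 13)`, `(1, -1, 7)`
and `(1, -1, 37)`. Of the eight 7-neighbours of `(1, -1, 1)`, three fall in the first class, three
in the last and two return, so the first plus the last is twice `(1, -1, 1)` up to `log 7`; `(1, -1,
7)` differs from `(1, -1, 1)` by a multiple of `log 3`. -/
theorem lambertL_identity :
    5 * √3 / 36 * π + 13 / 12 * log 3 - log 7 = lambertL 7 - 2 * lambertL 9 + lambertL 21 := by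
  have h1 := formEta_hecke Nat.prime_two (a := 3) (b := 0) (c := 49) (by norm_num) (by norm_num)
  have h2 := formEta_hecke Nat.prime_two (a := 1) (b := 0) (c := 147) (by norm_num) (by norm_num)
  have h3 := formEta_hecke (p := 7) (by norm_num) (a := 1) (b := -1) (c := 1)
    (by norm_num) (by norm_num)
  have h4 := formEta_one_neg_one_seven
  have h5 := formEta_one_zero_twentySeven
  norm_num [Finset.sum_range_succ] at h1 h2 h3
  have e1 : formEta 12 (-12) 52 = formEta 3 (-3) 13 := by
    apply formEta_shift 0 (k := 4) <;> norm_num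
  have e2 : formEta 4 (-4) 148 = formEta 1 (-1) 37 := by
    apply formEta_shift 0 (k := 4) <;> norm_num
  have e3 : formEta 1 (-7) 49 = formEta 1 (-1) 37 := by
    apply formEta_shift 3 (k := 1) <;> norm_num
  have f0 : formEta 49 (-7) 1 = formEta 1 (-1) 37 := by
    apply formEta_equiv 0 (-4) (k := 1) <;> norm_num
  have f1 : formEta 49 (-21) 3 = formEta 3 (-3) 13 := by
    apply formEta_equiv 0 (-4) (k := 1) <;> norm_num
  have f2 : formEta 49 (-35) 7 = formEta 1 (-1) 1 := by
    apply formEta_equiv 0 (-3) (k := 7) <;> norm_num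
  have f3 : formEta 49 (-49) 13 = formEta 13 (-3) 3 := by
    apply formEta_equiv 0 (-2) (k := 1) <;> norm_num
  have f3' : formEta 13 (-3) 3 = formEta 3 (-3) 13 := by
    apply formEta_equiv 0 (-1) (k := 1) <;> norm_num
  have f4 : formEta 49 (-63) 21 = formEta 1 (-1) 1 := by
    apply formEta_equiv 1 2 (k := 7) <;> norm_num
  have f5 : formEta 49 (-77) 31 = formEta 3 (-3) 13 := by
    apply formEta_equiv 1 3 (k := 1) <;> norm_num
  have f6 : formEta 49 (-91) 43 = formEta 1 (-1) 37 := by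
    apply formEta_equiv 1 3 (k := 1) <;> norm_num
  have s7 := lambertL_eq (d := 7) (a := 3) (c := 49) (k := 1) (by norm_num) (by norm_num)
    (by norm_num) (by norm_num)
  have s9 := lambertL_eq (d := 9) (a := 1) (c := 27) (k := 3) (by norm_num) (by norm_num)
    (by norm_num) (by norm_num)
  have s21 := lambertL_eq (d := 21) (a := 1) (c := 147) (k := 3) (by norm_num) (by norm_num)
    (by norm_num) (by norm_num)
  have l9 : log 9 = log 3 + log 3 := by rw [← log_mul] <;> norm_num
  have l21 : log 21 = log 3 + log 7 := by rw [← log_mul] <;> norm_num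
  norm_num at s7 s9 s21
  rw [s7, s9, s21, l9, l21]
  linarith

end Identities

theorem mainTheorem8 :
    -- every series `S_1(q_s^d)` converges, with ratio of successive terms tending to `q_s^d`
    (∀ (s : ℝ) (d : ℕ), 0 < s → 1 ≤ d →
      Summable (fun n : ℕ => lambertTerm 1 (nomeQ s ^ d) (n + 1)) ∧
      Filter.Tendsto
        (fun n : ℕ => lambertTerm 1 (nomeQ s ^ d) (n + 2) / lambertTerm 1 (nomeQ s ^ d) (n + 1))
        Filter.atTop (nhds (nomeQ s ^ d))) ∧
    -- Family A
    (lambertS 1 (nomeQ 7) - 2 * lambertS 1 (nomeQ 7 ^ 2) + lambertS 1 (nomeQ 7 ^ 4)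
      = -(Real.sqrt 7 / 24) * Real.pi + 1 / 2 * Real.log 2) ∧
    -- Family B
    (2 * lambertS 1 (nomeQ 2 ^ 2) - lambertS 1 (nomeQ 2 ^ 3) - lambertS 1 (nomeQ 2 ^ 6)
      = 5 * Real.sqrt 2 / 24 * Real.pi + 1 / 4 * Real.log 2 - Real.log 3) ∧
    -- Family C
    (lambertS 1 (nomeQ 1 ^ 3) + 2 * lambertS 1 (nomeQ 1 ^ 4) - 4 * lambertS 1 (nomeQ 1 ^ 6)
        + lambertS 1 (nomeQ 1 ^ 12)
      = 1 / 24 * Real.pi + Real.log 2 - 3 / 4 * Real.log 3) ∧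
    -- Family D
    (2 * lambertS 1 (nomeQ 1 ^ 4) + lambertS 1 (nomeQ 1 ^ 5) - 4 * lambertS 1 (nomeQ 1 ^ 10)
        + lambertS 1 (nomeQ 1 ^ 20)
      = 7 / 24 * Real.pi + Real.log 2 - Real.log 5) ∧
    -- Family E
    (lambertS 1 (nomeQ 3 ^ 2) + lambertS 1 (nomeQ 3 ^ 3) - 3 * lambertS 1 (nomeQ 3 ^ 6)
        + lambertS 1 (nomeQ 3 ^ 12)
      = Real.sqrt 3 / 24 * Real.pi + 1 / 3 * Real.log 2 - 5 / 12 * Real.log 3) ∧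
    -- the fast identity
    (5 * Real.sqrt 3 / 36 * Real.pi + 13 / 12 * Real.log 3 - Real.log 7
      = lambertL 7 - 2 * lambertL 9 + lambertL 21) ∧
    -- it converges faster than each of the five identities above
    (∀ p ∈ ({(7, 1), (2, 2), (1, 3), (1, 4), (3, 2)} : Set (ℝ × ℕ)),
      nomeQ (1 / 3) ^ 7 < nomeQ p.1 ^ p.2) ∧
    -- each of its nine Lambert series is at most `S_1(q_{1/3}^7) < 3.062 * 10⁻⁶`
    (∀ d ∈ ({7, 9, 14, 18, 21, 28, 36, 42, 84} : Set ℕ),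
      lambertS 1 (nomeQ (1 / 3) ^ d) ≤ lambertS 1 (nomeQ (1 / 3) ^ 7)) ∧
    lambertS 1 (nomeQ (1 / 3) ^ 7) < 3.062 * (10 : ℝ)⁻¹ ^ 6 := by
  refine ⟨fun s d hs hd ↦ ?_, lambertS_identity_sqrt_seven, lambertS_identity_sqrt_two,
    lambertS_identity_one_three, lambertS_identity_one_five, lambertS_identity_sqrt_three,
    lambertL_identity, ?_, fun d hd ↦ ?_, lambertS_nomeQ_third_pow_seven_lt⟩
  · have h0 : 0 < nomeQ s ^ d := pow_pos (nomeQ_pos s) d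
    have h1 : nomeQ s ^ d < 1 := pow_lt_one₀ (nomeQ_pos s).le (nomeQ_lt_one hs) (by omega)
    exact ⟨summable_lambertTerm_one h0 h1, tendsto_lambertTerm_one_ratio h0 h1⟩
  -- Squaring the exponents turns each comparison of nomes into one of rationals, with `49 / 3 = 7²
  -- / 3`.
  · have key {t : ℝ} {d : ℕ} (h : (d : ℝ) ^ 2 * t < 49 / 3) :
        nomeQ (1 / 3) ^ 7 < nomeQ t ^ d := by
      apply nomeQ_pow_lt_nomeQ_pow
      have hsqrt (c : ℕ) (x : ℝ) : (c : ℝ) * √x = √((c : ℝ) ^ 2 * x) := by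
        rw [Real.sqrt_mul (sq_nonneg _), Real.sqrt_sq c.cast_nonneg]
      rw [hsqrt, hsqrt]
      rw [Real.sqrt_lt_sqrt_iff_of_pos (by norm_num)]
      exact h.trans_le (by norm_num)
    rintro p (rfl | rfl | rfl | rfl | rfl) <;> apply key <;> norm_num
  · have h7 : 7 ≤ d := by
      rcases hd with rfl | rfl | rfl | rfl | rfl | rfl | rfl | rfl | rfl <;> norm_num
    have hq := nomeQ_lt_one (show (0 : ℝ) < 1 / 3 by norm_num)
    exact lambertS_one_mono (pow_pos (nomeQ_pos _) d)
      (pow_le_pow_of_le_one (nomeQ_pos _).le hq.le h7)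
      (pow_lt_one₀ (nomeQ_pos _).le hq (by norm_num))
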